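/- Let $\mathcal A$ be a central hyperplane arrangement in $\mathbb R^n$, i.e. a finite nonempty set of codimension-one linear subspaces. Its regions are the closures of the connected components of $\mathbb R^n\setminus\bigcup_{H\in\mathcal A}H$. Fix a region $B$ (the base region). For a region $R$ let $S(R)\subseteq\mathcal A$ be the set of hyperplanes of $\mathcal A$ separating $R$ from $B$. The poset of regions $\mathcal P(\mathcal A,B)$ is the set of regions of $\mathcal A$ ordered by $R_1\le R_2$ if and only if $S(R_1)\subseteq S(R_2)$. The basic digraph $\mathcal D(\mathcal A,B)$ has vertex set $\mathcal A$ and an edge $H_1\to H_2$, for $H_1\ne H_2$, whenever $H_1$ is basic in the rank-two subarrangement $\mathcal A'=\{H\in\mathcal A: H\supseteq H_1\cap H_2\}$, that is, whenever $H_1$ contains a facet of the region $B'$ of $\mathcal A'$ that contains $B$. The order dimension $\dim(P)$ of a finite poset $P$ is the smallest $d$ such that the order of $P$ is the intersection, as relations, of $d$ linear extensions of $P$. Let $\mathcal A=I_1\cup\dots\cup I_k$ be a partition into pairwise disjoint sets such that each $I_j$ induces an acyclic sub-digraph of $\mathcal D(\mathcal A,B)$, i.e. one without directed cycles (two-cycles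 included). Then $$\dim\mathcal P(\mathcal A,B)\le k.$$ Moreover, an explicit embedding is given as follows. Each $I=I_j$ can be listed as $H_1,\dots,H_{|I|}$ so that $H_a\to H_b$ in $\mathcal D(\mathcal A,B)$ implies $a<b$. For any such listing, let $\eta_I(R)$ be the number whose binary expansion is the word of length $|I|$ whose $i$-th letter (the first being the most significant) is $1$ if $H_i\in S(R)$ and $0$ otherwise, so that $\eta_I(R)\in[0,2^{|I|}-1]$. Then, for any choice of such listings, the map $\eta=(\eta_{I_1},\dots,\eta_{I_k}):\mathcal P(\mathcal A,B)\to\mathbb N^k$ is injective, and $R_1\le R_2$ if and only if $\eta_{I_j}(R_1)\le\eta_{I_j}(R_2)$ for all $j$. -/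

import Mathlib

/-! ### Order dimension -/

/-- The order of `P` is the intersection, as relations, of `d` linear extensions of `P`. -/
def IsIntersectionOfLinearExtensions (P : Type*) [PartialOrder P] (d : ℕ) : Prop :=
  ∃ L : Fin d → LinearOrder P,
    (∀ i x y, x ≤ y → (L i).le x y) ∧ ∀ x y, (∀ i, (L i).le x y) → x ≤ y

/-- The order dimension of a poset: the smallest `d` such that the order is the intersection of
`d` linear extensions (`⊤` if there is no such `d`). -/
noncomputable def orderDimension (P : Type*) [PartialOrder P] : ℕ∞ :=
  ⨅ (d : ℕ) (_ : IsIntersectionOfLinearExtensions P d), (d : ℕ∞)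

/-! ### Directed graphs -/

/-- The sub-digraph induced by a set of vertices. -/
def Digraph.inducedSubdigraph {V : Type*} (D : Digraph V) (I : Set V) : Digraph I where
  Adj v w := D.Adj v.1 w.1

/-- A digraph is acyclic if it has no directed cycle (of any length). -/
def Digraph.HasNoDirectedCycle {V : Type*} (D : Digraph V) : Prop :=
  ∀ v, ¬ Relation.TransGen D.Adj v v

/-! ### Regions of a collection of hyperplanes -/

namespace HyperplaneArrangement

/-- The complement of the union of a collection of subspaces. -/
def complement {n : ℕ} (𝓗 : Set (Submodule ℝ (EuclideanSpace ℝ (Fin n)))) :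
    Set (EuclideanSpace ℝ (Fin n)) :=
  {x | ∀ H ∈ 𝓗, x ∉ H}

/-- Regions are the closures of the connected components of the complement. -/
def IsRegion {n : ℕ} (𝓗 : Set (Submodule ℝ (EuclideanSpace ℝ (Fin n))))
    (R : Set (EuclideanSpace ℝ (Fin n))) : Prop :=
  ∃ x ∈ complement 𝓗, R = closure (connectedComponentIn (complement 𝓗) x)

/-- `H` separates `R₁` from `R₂`: they lie in opposite closed half-spaces bounded by `H`. -/
def Separates {n : ℕ} (H : Submodule ℝ (EuclideanSpace ℝ (Fin n)))
    (R₁ R₂ : Set (EuclideanSpace ℝ (Fin n))) : Prop :=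
  ∃ f : EuclideanSpace ℝ (Fin n) →ₗ[ℝ] ℝ, LinearMap.ker f = H ∧
    (∀ x ∈ R₁, 0 ≤ f x) ∧ ∀ x ∈ R₂, f x ≤ 0

/-- The hyperplane `H` bounds the region `R`: `R ∩ H` has codimension one, that is, it is a facet
of `R` spanning `H`. -/
def Bounds {n : ℕ} (H : Submodule ℝ (EuclideanSpace ℝ (Fin n)))
    (R : Set (EuclideanSpace ℝ (Fin n))) : Prop :=
  Submodule.span ℝ (R ∩ (H : Set (EuclideanSpace ℝ (Fin n)))) = H

end HyperplaneArrangement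

/-! ### Central arrangements -/

/-- A central hyperplane arrangement in `ℝⁿ`: a finite nonempty collection of linear subspaces of
codimension one. -/
structure CentralArrangement (n : ℕ) where
  hyperplanes : Finset (Submodule ℝ (EuclideanSpace ℝ (Fin n)))
  nonempty : hyperplanes.Nonempty
  codim_one : ∀ H ∈ hyperplanes, Module.finrank ℝ (EuclideanSpace ℝ (Fin n) ⧸ H) = 1

namespace CentralArrangement

open HyperplaneArrangement

/-- The regions of the arrangement. -/
def Region {n : ℕ} (A : CentralArrangement n) : Type :=
  {R : Set (EuclideanSpace ℝ (Fin n)) // IsRegion (A.hyperplanes : Set _) R}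

/-- The set `S(R₁, R₂)` of hyperplanes of the arrangement separating `R₁` from `R₂`. -/
def separatingSet {n : ℕ} (A : CentralArrangement n) (R₁ R₂ : A.Region) : Set A.hyperplanes :=
  {H | Separates H.1 R₁.1 R₂.1}

lemma exists_functional {n : ℕ} (A : CentralArrangement n)
    {H : Submodule ℝ (EuclideanSpace ℝ (Fin n))} (hH : H ∈ A.hyperplanes) :
    ∃ f : EuclideanSpace ℝ (Fin n) →ₗ[ℝ] ℝ, LinearMap.ker f = H := by
  have e : (EuclideanSpace ℝ (Fin n) ⧸ H) ≃ₗ[ℝ] ℝ :=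
    LinearEquiv.ofFinrankEq _ _ (by rw [A.codim_one H hH, Module.finrank_self])
  exact ⟨e.toLinearMap ∘ₗ H.mkQ, by rw [LinearEquiv.ker_comp, Submodule.ker_mkQ]⟩

/-- A functional vanishing exactly on a hyperplane of the arrangement has constant sign on a
region. -/
lemma nonneg_of_pos {n : ℕ} (A : CentralArrangement n)
    {f : EuclideanSpace ℝ (Fin n) →ₗ[ℝ] ℝ} (hf : LinearMap.ker f ∈ A.hyperplanes)
    {x : EuclideanSpace ℝ (Fin n)} (hx : x ∈ complement (A.hyperplanes : Set _)) (hpos : 0 < f x) :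
    ∀ y ∈ closure (connectedComponentIn (complement (A.hyperplanes : Set _)) x), 0 ≤ f y := by
  have hc : Continuous f := f.continuous_of_finiteDimensional
  have key : connectedComponentIn (complement (A.hyperplanes : Set _)) x ⊆ {y | 0 ≤ f y} := by
    intro y hy
    by_contra hneg
    have hneg' : f y < 0 := not_le.mp hneg
    obtain ⟨z, hz, hz0⟩ := isPreconnected_connectedComponentIn.intermediate_value hy
      (mem_connectedComponentIn hx) hc.continuousOn
      (show (0 : ℝ) ∈ Set.Icc (f y) (f x) from ⟨hneg'.le, hpos.le⟩)
    exact connectedComponentIn_subset _ _ hz _ hf hz0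
  exact closure_minimal key (isClosed_le continuous_const hc)

lemma separates_iff {n : ℕ} (A : CentralArrangement n)
    {f : EuclideanSpace ℝ (Fin n) →ₗ[ℝ] ℝ} (hf : LinearMap.ker f ∈ A.hyperplanes)
    {x b : EuclideanSpace ℝ (Fin n)} (hx : x ∈ complement (A.hyperplanes : Set _))
    (hb : b ∈ complement (A.hyperplanes : Set _)) :
    Separates (LinearMap.ker f)
      (closure (connectedComponentIn (complement (A.hyperplanes : Set _)) x))
      (closure (connectedComponentIn (complement (A.hyperplanes : Set _)) b)) ↔ f x * f b < 0 := by
  have hx0 : f x ≠ 0 := hx _ hf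
  have hb0 : f b ≠ 0 := hb _ hf
  have hnf : LinearMap.ker (-f) = LinearMap.ker f := by ext y; simp
  constructor
  · rintro ⟨g, hg, h1, h2⟩
    have hgx : 0 < g x := lt_of_le_of_ne (h1 x (subset_closure (mem_connectedComponentIn hx)))
      (fun h => hx _ hf (show x ∈ LinearMap.ker f by rw [← hg]; exact h.symm))
    have hgb : g b < 0 := lt_of_le_of_ne (h2 b (subset_closure (mem_connectedComponentIn hb)))
      (fun h => hb _ hf (show b ∈ LinearMap.ker f by rw [← hg]; exact h))
    -- a positive combination of `x` and `b` lies in the hyperplane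
    have hz : g (g x • b - g b • x) = 0 := by simp; ring
    have hz' : f (g x • b - g b • x) = 0 := by
      have : g x • b - g b • x ∈ LinearMap.ker f := by rw [← hg]; exact hz
      exact this
    have hz2 : g x * f b = g b * f x := by
      have := hz'
      simp only [map_sub, map_smul, smul_eq_mul] at this
      linarith
    have h3 : g x * (f x * f b) < 0 := by
      have : g x * (f x * f b) = g b * (f x * f x) := by linear_combination f x * hz2
      rw [this]
      exact mul_neg_of_neg_of_pos hgb (mul_self_pos.mpr hx0)
    by_contra hcon
    exact absurd h3 (not_lt.mpr (mul_nonneg hgx.le (not_lt.mp hcon)))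
  · intro h
    rcases lt_or_gt_of_ne hx0 with hneg | hpos
    · have hbpos : 0 < f b := by
        by_contra hcon
        exact absurd h (not_lt.mpr (mul_nonneg_of_nonpos_of_nonpos hneg.le (not_lt.mp hcon)))
      refine ⟨-f, hnf, ?_, ?_⟩
      · exact A.nonneg_of_pos (f := -f) (by rw [hnf]; exact hf) hx (by simpa using hneg)
      · intro y hy
        have := A.nonneg_of_pos hf hb hbpos y hy
        simpa using this
    · have hbneg : f b < 0 := by
        by_contra hcon
        exact absurd h (not_lt.mpr (mul_nonneg hpos.le (not_lt.mp hcon)))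
      refine ⟨f, rfl, A.nonneg_of_pos hf hx hpos, ?_⟩
      intro y hy
      have := A.nonneg_of_pos (f := -f) (by rw [hnf]; exact hf) hb (by simpa using hbneg) y hy
      simpa using this

/-- A region is determined by its separating set. -/
lemma separatingSet_injective {n : ℕ} (A : CentralArrangement n) (B : A.Region) {R₁ R₂ : A.Region}
    (h : A.separatingSet R₁ B = A.separatingSet R₂ B) : R₁ = R₂ := by
  obtain ⟨R₁, x, hx, rfl⟩ := R₁
  obtain ⟨R₂, y, hy, rfl⟩ := R₂
  obtain ⟨B, b, hb, rfl⟩ := B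
  have hsub : segment ℝ x y ⊆ complement (A.hyperplanes : Set _) := by
    rintro z ⟨s, t, hs, ht, hst, rfl⟩ H hH hz
    obtain ⟨f, rfl⟩ := A.exists_functional hH
    have hiff : f x * f b < 0 ↔ f y * f b < 0 := by
      rw [← A.separates_iff hH hx hb, ← A.separates_iff hH hy hb]
      exact Set.ext_iff.mp h ⟨_, hH⟩
    have hx0 : f x ≠ 0 := hx _ hH
    have hy0 : f y ≠ 0 := hy _ hH
    have hb0 : f b ≠ 0 := hb _ hH
    have hz0 : s * (f x * f b) + t * (f y * f b) = 0 := by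
      have h0 : s * f x + t * f y = 0 := by
        have : f (s • x + t • y) = 0 := hz
        simpa using this
      linear_combination f b * h0
    have hxb := mul_ne_zero hx0 hb0
    have hyb := mul_ne_zero hy0 hb0
    have key : ∀ p q : ℝ, 0 < p → 0 < q → s * p + t * q ≠ 0 := by
      intro p q hp hq h0
      rcases hs.eq_or_lt with h1 | h1
      · have ht1 : t = 1 := by linarith
        rw [← h1, ht1] at h0
        linarith
      · have := mul_pos h1 hp
        have := mul_nonneg ht hq.le
        linarith
    rcases lt_or_gt_of_ne hxb with h1 | h1
    · exact key _ _ (neg_pos.mpr h1) (neg_pos.mpr (hiff.mp h1)) (by linear_combination -hz0)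
    · have h2 : 0 < f y * f b :=
        lt_of_le_of_ne (not_lt.mp fun h3 => absurd (hiff.mpr h3) (not_lt.mpr h1.le)) hyb.symm
      exact key _ _ h1 h2 hz0
  have hmem : y ∈ connectedComponentIn (complement (A.hyperplanes : Set _)) x :=
    (convex_segment x y).isPreconnected.subset_connectedComponentIn (left_mem_segment ℝ x y) hsub
      (right_mem_segment ℝ x y)
  exact Subtype.ext (congrArg closure (connectedComponentIn_eq hmem))

/-- The underlying set of the poset of regions `P(A, B)` with base region `B`. -/
def PosetOfRegions {n : ℕ} (A : CentralArrangement n) (_B : A.Region) : Type := A.Region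

/-- The poset of regions: `R₁ ≤ R₂` if and only if `S(R₁, B) ⊆ S(R₂, B)`. -/
instance {n : ℕ} (A : CentralArrangement n) (B : A.Region) : PartialOrder (A.PosetOfRegions B) where
  le R₁ R₂ := A.separatingSet R₁ B ⊆ A.separatingSet R₂ B
  le_refl _ := subset_rfl
  le_trans _ _ _ h₁ h₂ := Set.Subset.trans h₁ h₂
  le_antisymm _ _ h₁ h₂ := A.separatingSet_injective B (Set.Subset.antisymm h₁ h₂)

/-- The hyperplanes of the arrangement that contain `L`.  If `L` is the intersection of two
distinct hyperplanes of the arrangement, it has codimension two and this is the rank-two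
subarrangement determined by `L`. -/
def subarrangement {n : ℕ} (A : CentralArrangement n)
    (L : Submodule ℝ (EuclideanSpace ℝ (Fin n))) :
    Set (Submodule ℝ (EuclideanSpace ℝ (Fin n))) :=
  {H | H ∈ A.hyperplanes ∧ L ≤ H}

/-- `H` is basic in the subarrangement `𝓗`: it belongs to `𝓗` and bounds the region of `𝓗` that
contains the base region `B`. -/
def IsBasic {n : ℕ} (A : CentralArrangement n) (B : A.Region)
    (𝓗 : Set (Submodule ℝ (EuclideanSpace ℝ (Fin n))))
    (H : Submodule ℝ (EuclideanSpace ℝ (Fin n))) : Prop :=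
  H ∈ 𝓗 ∧ ∃ B' : Set (EuclideanSpace ℝ (Fin n)), IsRegion 𝓗 B' ∧ B.1 ⊆ B' ∧ Bounds H B'

/-- The basic digraph `D(A, B)`: there is an edge `H₁ → H₂` whenever `H₁ ≠ H₂` and `H₁` is basic in
the rank-two subarrangement determined by `H₁ ∩ H₂`. -/
def basicDigraph {n : ℕ} (A : CentralArrangement n) (B : A.Region) : Digraph A.hyperplanes where
  Adj H₁ H₂ := H₁ ≠ H₂ ∧ A.IsBasic B (A.subarrangement (H₁.1 ⊓ H₂.1)) H₁.1

/-- A listing `H₁, …, H_m` of the hyperplanes in `I` is compatible with the basic digraph if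
`H_a → H_b` implies `a < b`. -/
def IsCompatibleOrdering {n : ℕ} (A : CentralArrangement n) (B : A.Region)
    {I : Set A.hyperplanes} {m : ℕ} (e : Fin m ≃ I) : Prop :=
  ∀ a b : Fin m, (A.basicDigraph B).Adj (e a).1 (e b).1 → a < b

open Classical in
/-- The map `η_I` attached to a listing `H₁, …, H_m` of `I`: the value of the binary word of length
`m` whose `i`-th letter, counted from the most significant one, is `1` if `H_i ∈ S(R, B)` and `0`
otherwise. -/
noncomputable def eta {n : ℕ} (A : CentralArrangement n) (B : A.Region)
    {I : Set A.hyperplanes} {m : ℕ} (e : Fin m ≃ I) (R : A.PosetOfRegions B) : ℕ :=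
  ∑ i : Fin m, if (e i).1 ∈ A.separatingSet R B then 2 ^ (i.rev : ℕ) else 0

end CentralArrangement

/-!
The equivalence `R₁ ≤ R₂ ↔ ∀ j, η_j R₁ ≤ η_j R₂` carries everything: injectivity of `η` is
antisymmetry, and breaking the ties of each `η_j` by one fixed linear extension of the poset of
regions gives `k` linear extensions whose intersection is the order.

Each `η_j` is monotone, since enlarging `S(R)` only turns zeros of the binary word into ones.  For
the converse, fix a point `b` inside the base region and normalize the functional `f_K` of each
hyperplane `K` by `f_K b = 1`, so that `K` separates the region of `x` from the base region exactly
when `f_K x < 0` (`mem_separatingSet_iff`).  Let `S(R₁) ⊄ S(R₂)`.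

* Moving a point of `R₁` in the direction `b` raises all `f_K` by the same amount, so hyperplanes
  leave the separating set one by one if the point is generic.  Stopping just before the last
  hyperplane outside `S(R₂)` disappears yields a region `X ≤ R₁` for which `S(X) \ S(R₂)` is a single
  hyperplane `H` (`exists_le_diff_eq_singleton`).
* If moreover `H' ∈ S(R₂) \ S(X)`, then `H → H'` in the basic digraph
  (`basicDigraph_adj_of_diff_eq_singleton`).  Indeed every `K ⊇ H ∩ H'` has `f_K = α f_H + β f_H'`,
  and `β < 0` would force `α > 0`, hence `f_K < 0` on `X` and `f_K > 0` on `R₂`, so that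
  `K ∈ S(X) \ S(R₂) = {H}`, although `β ≠ 0`.  Thus `β ≥ 0` for all `K`, which says that `H` bounds the
  rank-two region around `b`.
* Consequently, in the listing of the block `I_j` containing `H`, no hyperplane before `H` lies in
  `S(R₂) \ S(X)`, so `H` decides the comparison of the binary words:
  `η_j R₂ < η_j X ≤ η_j R₁`.
-/

/-! ### Binary words -/

/-- A binary word of length `m` has value less than `2 ^ m`. -/
lemma sum_ite_two_pow_rev_lt {m : ℕ} (p : Fin m → Prop) [DecidablePred p] :
    (∑ i : Fin m, if p i then 2 ^ (i.rev : ℕ) else 0) < 2 ^ m := by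
  induction m with
  | zero => simp
  | succ m ih =>
    rw [Fin.sum_univ_succ]
    have h := ih fun i => p i.succ
    simp only [Fin.rev_zero, Fin.val_last, Fin.rev_succ, Fin.val_castSucc]
    rw [pow_succ]
    split_ifs <;> omega

/-- A letter `1` of `p` facing a letter `0` of `q` makes the word of `p` larger if no earlier letter
is `1` in `q` and `0` in `p`. -/
lemma sum_ite_two_pow_rev_lt_sum {m : ℕ} (p q : Fin m → Prop) [DecidablePred p] [DecidablePred q]
    (a : Fin m) (hp : p a) (hq : ¬ q a) (h : ∀ i < a, q i → p i) :
    (∑ i : Fin m, if q i then 2 ^ (i.rev : ℕ) else 0) <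
      ∑ i : Fin m, if p i then 2 ^ (i.rev : ℕ) else 0 := by
  induction m with
  | zero => exact a.elim0
  | succ m ih =>
    rw [Fin.sum_univ_succ, Fin.sum_univ_succ]
    simp only [Fin.rev_zero, Fin.val_last, Fin.rev_succ, Fin.val_castSucc]
    cases a using Fin.cases with
    | zero =>
      have hlt := sum_ite_two_pow_rev_lt fun i : Fin m => q i.succ
      rw [if_pos hp, if_neg hq]
      omega
    | succ a =>
      have hlt := ih (fun i => p i.succ) (fun i => q i.succ) a hp hq
        fun i hi => h i.succ (Fin.succ_lt_succ_iff.mpr hi)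
      have h0 := h 0 a.succ_pos
      refine add_lt_add_of_le_of_lt ?_ hlt
      split_ifs <;> simp_all

/-! ### Order dimension and acyclic digraphs -/

/-- Maps to `ℕ` that are monotone and together reflect the order bound the order dimension. -/
lemma orderDimension_le_of_le_iff {P : Type*} [PartialOrder P] {k : ℕ} (g : Fin k → P → ℕ)
    (hg : ∀ x y, x ≤ y ↔ ∀ j, g j x ≤ g j y) : orderDimension P ≤ k := by
  -- `g j`, with ties broken by a fixed linear extension of `P`
  let φ (j : Fin k) (x : P) : ℕ ×ₗ LinearExtension P := toLex (g j x, toLinearExtension x)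
  have hφ (j : Fin k) : Function.Injective (φ j) := fun x y hxy =>
    congrArg Prod.snd (toLex.injective hxy)
  refine iInf₂_le k ⟨fun j => LinearOrder.lift' (φ j) (hφ j), fun j x y hxy => ?_,
    fun x y hxy => (hg x y).mpr fun j => ?_⟩
  · change φ j x ≤ φ j y
    exact Prod.Lex.toLex_mono (a := (g j x, toLinearExtension x))
      ⟨(hg x y).mp hxy j, toLinearExtension.monotone hxy⟩
  · have h : φ j x ≤ φ j y := hxy j
    rw [Prod.Lex.toLex_le_toLex] at h
    exact h.elim le_of_lt fun h => h.1.le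

/-- The vertices of a finite acyclic digraph can be listed so that all edges go forward. -/
lemma Digraph.HasNoDirectedCycle.exists_equiv_fin {V : Type*} [Finite V] {D : Digraph V}
    (hD : D.HasNoDirectedCycle) :
    ∃ e : Fin (Nat.card V) ≃ V, ∀ a b, D.Adj (e a) (e b) → a < b := by
  have : Std.Irrefl (Relation.TransGen D.Adj) := ⟨hD⟩
  have : IsStrictOrder V (Relation.TransGen D.Adj) := {}
  let : PartialOrder V := partialOrderOfSO (Relation.TransGen D.Adj)
  have : Finite (LinearExtension V) := ‹Finite V›
  have : Fintype (LinearExtension V) := Fintype.ofFinite _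
  let e : Fin (Nat.card V) ≃o LinearExtension V :=
    Fintype.orderIsoFinOfCardEq _ Nat.card_eq_fintype_card.symm
  have hlt (v w : V) (h : D.Adj v w) : toLinearExtension v < toLinearExtension w :=
    toLinearExtension.monotone.strictMono_of_injective (fun _ _ h => h)
      (show v < w from Relation.TransGen.single h)
  exact ⟨e.toEquiv, fun a b hab => e.lt_iff_lt.mp (hlt _ _ hab)⟩

namespace CentralArrangement

open HyperplaneArrangement Filter Topology

variable {n : ℕ} (A : CentralArrangement n)

/-! ### Normalized functionals -/

/-- Functionals defining the hyperplanes of `A`, normalized to take the value `1` at `b`. -/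
structure NormalizedFunctionals (b : EuclideanSpace ℝ (Fin n)) where
  /-- The functional of each hyperplane. -/
  toFun : A.hyperplanes → EuclideanSpace ℝ (Fin n) →ₗ[ℝ] ℝ
  ker_eq : ∀ H, LinearMap.ker (toFun H) = H.1
  apply_base : ∀ H, toFun H b = 1

lemma nonempty_normalizedFunctionals {b : EuclideanSpace ℝ (Fin n)}
    (hb : b ∈ complement (A.hyperplanes : Set _)) : Nonempty (A.NormalizedFunctionals b) := by
  choose f hf using fun H : A.hyperplanes => A.exists_functional H.2
  have h0 (H : A.hyperplanes) : f H b ≠ 0 := fun h => hb H.1 H.2 (hf H ▸ h)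
  exact ⟨⟨fun H => (f H b)⁻¹ • f H,
    fun H => by rw [LinearMap.ker_smul _ _ (inv_ne_zero (h0 H)), hf H],
    fun H => by simp [h0 H]⟩⟩

/-- The region containing a point of the complement. -/
def regionOf (x : EuclideanSpace ℝ (Fin n)) (hx : x ∈ complement (A.hyperplanes : Set _)) :
    A.Region :=
  ⟨closure (connectedComponentIn (complement (A.hyperplanes : Set _)) x), x, hx, rfl⟩

lemma exists_eq_regionOf (R : A.Region) : ∃ x hx, R = A.regionOf x hx := by
  obtain ⟨R, x, hx, rfl⟩ := R
  exact ⟨x, hx, rfl⟩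

variable {A} {b x y : EuclideanSpace ℝ (Fin n)}

namespace NormalizedFunctionals

variable (F : A.NormalizedFunctionals b)

lemma apply_eq_zero_iff {H : A.hyperplanes} {z : EuclideanSpace ℝ (Fin n)} :
    F.toFun H z = 0 ↔ z ∈ H.1 := by
  rw [← F.ker_eq H, LinearMap.mem_ker]

lemma mem_complement_iff {z : EuclideanSpace ℝ (Fin n)} :
    z ∈ complement (A.hyperplanes : Set _) ↔ ∀ H, F.toFun H z ≠ 0 :=
  ⟨fun hz H h => hz H.1 H.2 (F.apply_eq_zero_iff.mp h),
    fun h H hH hz => h ⟨H, hH⟩ (F.apply_eq_zero_iff.mpr hz)⟩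

lemma injective : Function.Injective F.toFun := fun H K h =>
  Subtype.ext (by rw [← F.ker_eq H, ← F.ker_eq K, h])

lemma mem_separatingSet_iff (hb : b ∈ complement (A.hyperplanes : Set _))
    (hx : x ∈ complement (A.hyperplanes : Set _)) {H : A.hyperplanes} :
    H ∈ A.separatingSet (A.regionOf x hx) (A.regionOf b hb) ↔ F.toFun H x < 0 := by
  have h := A.separates_iff (f := F.toFun H) (by rw [F.ker_eq]; exact H.2) hx hb
  rw [F.apply_base, mul_one, F.ker_eq] at h
  exact h

/-- Every functional vanishing on `H ∩ H'` is a combination of the functionals of `H` and `H'`. -/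
lemma exists_eq_add {H H' K : A.hyperplanes} (hK : H.1 ⊓ H'.1 ≤ K.1) :
    ∃ α β : ℝ, α + β = 1 ∧ ∀ z, F.toFun K z = α * F.toFun H z + β * F.toFun H' z := by
  have hmem : F.toFun K ∈ Submodule.span ℝ (Set.range ![F.toFun H, F.toFun H']) := by
    apply mem_span_of_iInf_ker_le_ker
    intro z hz
    simp only [Submodule.mem_iInf, Fin.forall_fin_two] at hz
    rw [F.ker_eq]
    exact hK ⟨by simpa [F.apply_eq_zero_iff] using hz.1, by simpa [F.apply_eq_zero_iff] using hz.2⟩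
  rw [Matrix.range_cons_cons_empty, Submodule.mem_span_pair] at hmem
  obtain ⟨α, β, h⟩ := hmem
  have hval (z) : F.toFun K z = α * F.toFun H z + β * F.toFun H' z := by simp [← h]
  exact ⟨α, β, by simpa [F.apply_base] using (hval b).symm, hval⟩

/-- Near a point of the complement there is one with the same signs at which the normalized
functionals take distinct values. -/
lemma exists_generic (hx : x ∈ complement (A.hyperplanes : Set _)) :
    ∃ z, (∀ H, F.toFun H z < 0 → F.toFun H x < 0) ∧
      (∀ H, F.toFun H x < 0 → F.toFun H z < 0) ∧ Function.Injective fun H => F.toFun H z := by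
  have hx0 := F.mem_complement_iff.mp hx
  obtain ⟨v, hv⟩ := Module.Dual.exists_forall_ne_zero_of_forall_exists
    (fun p : {p : A.hyperplanes × A.hyperplanes // p.1 ≠ p.2} => F.toFun p.1.1 - F.toFun p.1.2)
    (fun p => by
      by_contra! h
      exact p.2 (F.injective (sub_eq_zero.mp (LinearMap.ext h))))
  have hline (c d : ℝ) : Tendsto (fun ε : ℝ => c + ε * d) (𝓝[≠] 0) (𝓝 c) := by
    have : Continuous fun ε : ℝ => c + ε * d := by fun_prop
    simpa using (this.tendsto 0).mono_left nhdsWithin_le_nhds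
  have hsign : ∀ᶠ ε : ℝ in 𝓝[≠] 0, ∀ H, 0 < F.toFun H x * (F.toFun H x + ε * F.toFun H v) :=
    eventually_all.mpr fun H =>
      ((hline _ (F.toFun H v)).const_mul (F.toFun H x)).eventually_const_lt
        (mul_self_pos.mpr (hx0 H))
  have hinj : ∀ᶠ ε : ℝ in 𝓝[≠] 0, ∀ p : {p : A.hyperplanes × A.hyperplanes // p.1 ≠ p.2},
      (F.toFun p.1.1 - F.toFun p.1.2) x + ε * (F.toFun p.1.1 - F.toFun p.1.2) v ≠ 0 := by
    refine eventually_all.mpr fun p => ?_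
    by_cases h : (F.toFun p.1.1 - F.toFun p.1.2) x = 0
    · filter_upwards [self_mem_nhdsWithin] with ε hε
      rw [h, zero_add]
      exact mul_ne_zero hε (hv p)
    · exact (hline _ _).eventually_ne h
  obtain ⟨ε, h1, h2⟩ := (hsign.and hinj).exists
  have hval (H) : F.toFun H (x + ε • v) = F.toFun H x + ε * F.toFun H v := by simp
  refine ⟨x + ε • v, fun H h => ?_, fun H h => ?_, fun H K h => ?_⟩
  · have := h1 H
    rw [← hval] at this
    exact (neg_iff_neg_of_mul_pos this).mpr h
  · have := h1 H
    rw [← hval] at this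
    exact (neg_iff_neg_of_mul_pos this).mp h
  · by_contra hne
    refine h2 ⟨(H, K), hne⟩ ?_
    have h' : F.toFun H (x + ε • v) = F.toFun K (x + ε • v) := h
    rw [hval, hval] at h'
    simp only [LinearMap.sub_apply]
    linarith

end NormalizedFunctionals

/-! ### Crossing hyperplanes one at a time -/

/-- If `R₁ ≰ R₂`, then `R₁` can be lowered to a region `X` such that exactly one hyperplane of
`S(X)` lies outside `S(R₂)`. -/
lemma exists_le_diff_eq_singleton {B R₁ R₂ : A.Region}
    (h : ¬ A.separatingSet R₁ B ⊆ A.separatingSet R₂ B) :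
    ∃ (X : A.Region) (H : A.hyperplanes), A.separatingSet X B ⊆ A.separatingSet R₁ B ∧
      A.separatingSet X B \ A.separatingSet R₂ B = {H} := by
  obtain ⟨b, hb, rfl⟩ := A.exists_eq_regionOf B
  obtain ⟨x, hx, rfl⟩ := A.exists_eq_regionOf R₁
  obtain ⟨F⟩ := A.nonempty_normalizedFunctionals hb
  set S₂ := A.separatingSet R₂ (A.regionOf b hb)
  obtain ⟨z, hzx, hxz, hinj⟩ := F.exists_generic hx
  obtain ⟨H₀, hH₀, hH₀'⟩ := Set.not_subset.mp h
  -- `H` is the last hyperplane outside `S₂` crossed on the way from `z` in the direction `b`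
  obtain ⟨H, ⟨hHz, hH₂⟩, hmin⟩ := Set.exists_min_image {H | F.toFun H z < 0 ∧ H ∉ S₂}
    (fun H => F.toFun H z) (Set.toFinite _)
    ⟨H₀, hxz _ ((F.mem_separatingSet_iff hb hx).mp hH₀), hH₀'⟩
  -- stop at `z - s • b` just before crossing `H`
  have hs : ∀ᶠ s : ℝ in 𝓝[>] (F.toFun H z), s < 0 ∧
      ∀ K, F.toFun H z < F.toFun K z → s < F.toFun K z := by
    refine Eventually.and ?_ (eventually_all.mpr fun K => eventually_imp_distrib_left.mpr fun hK => ?_)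
    · exact eventually_nhdsWithin_of_eventually_nhds (eventually_lt_nhds hHz)
    · exact eventually_nhdsWithin_of_eventually_nhds (eventually_lt_nhds hK)
  obtain ⟨s, ⟨hs0, hsK⟩, hHs : F.toFun H z < s⟩ := (hs.and self_mem_nhdsWithin).exists
  have hval (K) : F.toFun K (z - s • b) = F.toFun K z - s := by simp [F.apply_base]
  have hy : z - s • b ∈ complement (A.hyperplanes : Set _) := by
    refine F.mem_complement_iff.mpr fun K hK => ?_
    rw [hval] at hK
    rcases lt_or_ge (F.toFun H z) (F.toFun K z) with hlt | hle
    · linarith [hsK K hlt]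
    · linarith
  refine ⟨A.regionOf _ hy, H, fun K hK => ?_, Set.eq_singleton_iff_unique_mem.mpr
    ⟨⟨?_, hH₂⟩, fun K hK => ?_⟩⟩
  · rw [F.mem_separatingSet_iff hb hy, hval] at hK
    exact (F.mem_separatingSet_iff hb hx).mpr (hzx K (by linarith))
  · rw [F.mem_separatingSet_iff hb hy, hval]
    linarith
  · obtain ⟨hK, hK₂⟩ := hK
    rw [F.mem_separatingSet_iff hb hy, hval] at hK
    have hle := hmin K ⟨by linarith, hK₂⟩
    have hge : F.toFun K z ≤ F.toFun H z := not_lt.mp fun hlt => by linarith [hsK K hlt]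
    exact hinj (le_antisymm hge hle)

/-! ### Edges of the basic digraph -/

/-- `H` bounds the region around `b` of the rank-two subarrangement of `H ∩ H'` if the functionals
of the subarrangement are nonnegative on the half `{f_H' ≥ 0}` of `H`. -/
lemma isBasic_of_nonneg (hb : b ∈ complement (A.hyperplanes : Set _))
    (F : A.NormalizedFunctionals b) (H H' : A.hyperplanes)
    (hpos : ∀ K : A.hyperplanes, H.1 ⊓ H'.1 ≤ K.1 → ∀ z ∈ H.1, 0 ≤ F.toFun H' z →
      0 ≤ F.toFun K z) :
    A.IsBasic (A.regionOf b hb) (A.subarrangement (H.1 ⊓ H'.1)) H.1 := by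
  set 𝓗 := A.subarrangement (H.1 ⊓ H'.1)
  have hsub : complement (A.hyperplanes : Set _) ⊆ complement 𝓗 := fun z hz K hK => hz K hK.1
  refine ⟨⟨H.2, inf_le_left⟩, _, ⟨b, hsub hb, rfl⟩, closure_mono (connectedComponentIn_mono b hsub),
    le_antisymm (Submodule.span_le.mpr Set.inter_subset_right) ?_⟩
  -- the half `{f_H' ≥ 0}` of `H` is in the closed region, by segments to `b`
  have hhalf : ∀ z ∈ H.1, 0 ≤ F.toFun H' z → z ∈ closure (connectedComponentIn (complement 𝓗) b) := by
    intro z hz hz'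
    set γ : ℝ → EuclideanSpace ℝ (Fin n) := fun t => z + t • (b - z)
    have hγ : Continuous γ := by fun_prop
    have himage : γ '' Set.Ioc 0 1 ⊆ connectedComponentIn (complement 𝓗) b := by
      refine (isPreconnected_Ioc.image γ hγ.continuousOn).subset_connectedComponentIn
        ⟨1, by simp, by simp [γ]⟩ ?_
      rintro _ ⟨t, ⟨ht0, ht1⟩, rfl⟩ K hK hmem
      have h0 := (F.apply_eq_zero_iff (H := ⟨K, hK.1⟩)).mpr hmem
      have hKz := hpos ⟨K, hK.1⟩ hK.2 z hz hz'
      have : (1 - t) * F.toFun ⟨K, hK.1⟩ z + t = 0 := by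
        simp only [γ, map_add, map_smul, map_sub, F.apply_base, smul_eq_mul] at h0
        linarith
      nlinarith [mul_nonneg (sub_nonneg.mpr ht1) hKz]
    have h0 : γ 0 ∈ closure (γ '' Set.Ioc 0 1) :=
      image_closure_subset_closure_image hγ ⟨0, by simp [closure_Ioc (zero_ne_one' ℝ)], rfl⟩
    simpa [γ] using closure_mono himage h0
  intro z hz
  rcases le_total 0 (F.toFun H' z) with h | h
  · exact Submodule.subset_span ⟨hhalf z hz h, hz⟩
  · rw [← neg_neg z]
    exact Submodule.neg_mem _ (Submodule.subset_span
      ⟨hhalf (-z) (H.1.neg_mem hz) (by simpa using h), H.1.neg_mem hz⟩)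

/-- If `H` is the only hyperplane in `S(R₁) \ S(R₂)`, then it has an edge to every hyperplane in
`S(R₂) \ S(R₁)`. -/
lemma basicDigraph_adj_of_diff_eq_singleton {B R₁ R₂ : A.Region} {H H' : A.hyperplanes}
    (hH : A.separatingSet R₁ B \ A.separatingSet R₂ B = {H})
    (hH' : H' ∈ A.separatingSet R₂ B \ A.separatingSet R₁ B) : (A.basicDigraph B).Adj H H' := by
  have hHmem : H ∈ A.separatingSet R₁ B \ A.separatingSet R₂ B := hH ▸ rfl
  obtain ⟨b, hb, rfl⟩ := A.exists_eq_regionOf B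
  obtain ⟨x, hx, rfl⟩ := A.exists_eq_regionOf R₁
  obtain ⟨y, hy, rfl⟩ := A.exists_eq_regionOf R₂
  obtain ⟨F⟩ := A.nonempty_normalizedFunctionals hb
  have hdiff (K) (h₁ : F.toFun K x < 0) (h₂ : 0 < F.toFun K y) : K = H := by
    have : K ∈ ({H} : Set A.hyperplanes) := by
      rw [← hH, Set.mem_sdiff, F.mem_separatingSet_iff hb hx, F.mem_separatingSet_iff hb hy]
      exact ⟨h₁, not_lt.mpr h₂.le⟩
    exact this
  simp only [Set.mem_sdiff, F.mem_separatingSet_iff hb hx, F.mem_separatingSet_iff hb hy,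
    not_lt] at hHmem hH'
  obtain ⟨hHx, hHy⟩ := hHmem
  obtain ⟨hHy', hHx'⟩ := hH'
  replace hHy := hHy.lt_of_ne' (F.mem_complement_iff.mp hy H)
  replace hHx' := hHx'.lt_of_ne' (F.mem_complement_iff.mp hx H')
  refine ⟨fun h => by rw [h] at hHx; linarith, isBasic_of_nonneg hb F H H' fun K hK z hz hz' => ?_⟩
  obtain ⟨α, β, hαβ, hval⟩ := F.exists_eq_add hK
  have hz0 := F.apply_eq_zero_iff.mpr hz
  rw [hval, hz0, mul_zero, zero_add]
  refine mul_nonneg (not_lt.mp fun hβ => ?_) hz'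
  have hα : 0 < α := by linarith
  obtain rfl : K = H := hdiff K
    (by rw [hval]; exact add_neg (mul_neg_of_pos_of_neg hα hHx) (mul_neg_of_neg_of_pos hβ hHx'))
    (by rw [hval]; exact add_pos (mul_pos hα hHy) (mul_pos_of_neg_of_neg hβ hHy'))
  -- `K = H` is impossible: `x - f_K x • b` lies in `K`, but `f_H'` is positive there
  have hx' := hval (x - F.toFun K x • b)
  simp only [map_sub, map_smul, F.apply_base, smul_eq_mul, mul_one, sub_self, mul_zero,
    zero_add] at hx'
  exact (mul_neg_of_neg_of_pos hβ (sub_pos.mpr (hHx.trans hHx'))).ne hx'.symm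

/-! ### The binary embedding -/

lemma eta_le_two_pow_sub_one (B : A.Region) {I : Set A.hyperplanes} {m : ℕ} (e : Fin m ≃ I)
    (R : A.PosetOfRegions B) : A.eta B e R ≤ 2 ^ m - 1 := by
  classical
  exact Nat.le_sub_one_of_lt (sum_ite_two_pow_rev_lt _)

lemma eta_mono (B : A.Region) {I : Set A.hyperplanes} {m : ℕ} (e : Fin m ≃ I) :
    Monotone (A.eta B e) := by
  classical
  intro R₁ R₂ h
  refine Finset.sum_le_sum fun i _ => ?_
  have hi := @h (e i).1
  split_ifs <;> simp_all

/-- A compatible listing of a set `I` containing the only hyperplane of `S(R₁) \ S(R₂)` gives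
`η_I R₂ < η_I R₁`. -/
lemma eta_lt_of_diff_eq_singleton {B : A.Region} {I : Set A.hyperplanes} {m : ℕ} {e : Fin m ≃ I}
    (he : A.IsCompatibleOrdering B e) {R₁ R₂ : A.PosetOfRegions B} {H : A.hyperplanes}
    (hHI : H ∈ I) (hH : A.separatingSet R₁ B \ A.separatingSet R₂ B = {H}) :
    A.eta B e R₂ < A.eta B e R₁ := by
  classical
  have hHmem : H ∈ A.separatingSet R₁ B \ A.separatingSet R₂ B := hH ▸ rfl
  have ha : (e (e.symm ⟨H, hHI⟩)).1 = H := by simp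
  refine sum_ite_two_pow_rev_lt_sum _ _ (e.symm ⟨H, hHI⟩) (by rw [ha]; exact hHmem.1)
    (by rw [ha]; exact hHmem.2) fun i hi h₂ => ?_
  by_contra h₁
  have hadj := basicDigraph_adj_of_diff_eq_singleton hH ⟨h₂, h₁⟩
  exact hi.asymm (he _ _ (by rwa [ha]))

lemma le_iff_forall_eta_le {B : A.Region} {k : ℕ} {I : Fin k → Set A.hyperplanes}
    (hcover : ⋃ j, I j = Set.univ) {m : Fin k → ℕ} (e : (j : Fin k) → (Fin (m j) ≃ I j))
    (he : ∀ j, A.IsCompatibleOrdering B (e j)) (R₁ R₂ : A.PosetOfRegions B) :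
    R₁ ≤ R₂ ↔ ∀ j, A.eta B (e j) R₁ ≤ A.eta B (e j) R₂ := by
  refine ⟨fun h j => eta_mono B (e j) h, fun h => by_contra fun hle => ?_⟩
  obtain ⟨X, H, hX, hH⟩ := exists_le_diff_eq_singleton (B := B) (R₁ := R₁) (R₂ := R₂) hle
  obtain ⟨j, hj⟩ := Set.mem_iUnion.mp (hcover ▸ Set.mem_univ H)
  have h₁ := eta_lt_of_diff_eq_singleton (R₁ := X) (R₂ := R₂) (he j) hj hH
  have h₂ : A.eta B (e j) X ≤ A.eta B (e j) R₁ := eta_mono B (e j) hX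
  exact absurd (h j) (not_le.mpr (h₁.trans_le h₂))

end CentralArrangement

theorem theorem2 {n : ℕ} (A : CentralArrangement n) (B : A.Region) {k : ℕ}
    (I : Fin k → Set A.hyperplanes)
    (hdisj : Pairwise fun i j => Disjoint (I i) (I j))
    (hcover : ⋃ j, I j = Set.univ)
    (hacyclic : ∀ j, ((A.basicDigraph B).inducedSubdigraph (I j)).HasNoDirectedCycle) :
    orderDimension (A.PosetOfRegions B) ≤ (k : ℕ∞) ∧
    (∀ j, ∃ e : Fin (I j).ncard ≃ I j, A.IsCompatibleOrdering B e) ∧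
    ∀ e : (j : Fin k) → (Fin (I j).ncard ≃ I j), (∀ j, A.IsCompatibleOrdering B (e j)) →
      (∀ j R, A.eta B (e j) R ≤ 2 ^ (I j).ncard - 1) ∧
      (Function.Injective fun (R : A.PosetOfRegions B) (j : Fin k) => A.eta B (e j) R) ∧
      ∀ R₁ R₂ : A.PosetOfRegions B,
        R₁ ≤ R₂ ↔ ∀ j, A.eta B (e j) R₁ ≤ A.eta B (e j) R₂ := by
  have hlist (j : Fin k) : ∃ e : Fin (I j).ncard ≃ I j, A.IsCompatibleOrdering B e :=
    (hacyclic j).exists_equiv_fin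
  choose e₀ he₀ using hlist
  refine ⟨orderDimension_le_of_le_iff (fun j => A.eta B (e₀ j))
      (CentralArrangement.le_iff_forall_eta_le hcover e₀ he₀), fun j => ⟨e₀ j, he₀ j⟩,
    fun e he => ⟨fun j => CentralArrangement.eta_le_two_pow_sub_one B (e j), fun R₁ R₂ h => ?_,
      CentralArrangement.le_iff_forall_eta_le hcover e he⟩⟩
  have hle := CentralArrangement.le_iff_forall_eta_le hcover e he
  exact le_antisymm ((hle _ _).mpr fun j => (congrFun h j).le)
    ((hle _ _).mpr fun j => (congrFun h j).ge)
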